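/- Let $\Gamma$ be a countable group and $S$ a finite symmetric generating set of $\Gamma$ not containing the identity. Let $\Gamma$ act on $2^\Gamma=\{0,1\}^\Gamma$ (with the product topology) by $(g\cdot x)(h)=x(g^{-1}h)$, and let $F(2^\Gamma)=\{x\in 2^\Gamma : g\cdot x\neq x \text{ for all } g\in\Gamma\setminus\{\mathrm{id}\}\}$ with the subspace topology. The shift graph of $(\Gamma,S)$, also denoted $F(2^\Gamma)$, is the graph on the set $F(2^\Gamma)$ in which $x$ and $y$ are adjacent if and only if $s\cdot x=y$ for some $s\in S$. For a graph $G$ on a Polish space $X$ and a Borel probability measure $\mu$ on $X$, let $\chi_\mu(G)\in\mathbb{N}\cup\{\infty\}$ be the least $n$ such that $G$ has a $\mu$-measurable proper $n$-coloring, i.e. a map $c:X\to\{1,\dots,n\}$ with $c(x)\neq c(y)$ whenever $x,y$ are adjacent, each of whose color sets is measurable for the completion of $\mu$ ($\chi_\mu(G)=\infty$ if there is no such $n$). Let $\chi_M(G)$ be the supremum of $\chi_\mu(G)$ over all Borel probability measures $\mu$ on $X$. For $k\geq 3$ let $Z_k=\mathbb{Z}/k\mathbb{Z}$ and $S_k=\{(a,b)\in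 Z_k\times Z_k : a\neq 0,\ b\neq 0\}$. Let $\Delta_k$ be the direct product $(Z_k\times Z_k)\times\mathbb{Z}$, and let $\Gamma_k$ be the semidirect product $(Z_k\times Z_k)\rtimes\mathbb{Z}$ in which $1\in\mathbb{Z}$ acts on $Z_k\times Z_k$ by $(a,b)\mapsto(b,a)$; both have the generating set $S_k\times\{-1,0,1\}$. **Proposition.** For all $k\geq 3$, $$\chi_M(F(2^{\Gamma_k}))=2k-1\qquad\text{and}\qquad \chi_M(F(2^{\Delta_k}))=k+1 .$$ -/

import Mathlib

open MeasureTheory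

namespace ShiftGraphs

/-- A marking of a group `Γ`: a finite symmetric generating set of `Γ` not containing the identity.
A marked group is a group together with a marking. -/
structure Marking (Γ : Type*) [Group Γ] where
  /-- the generating set -/
  gens : Set Γ
  finite_gens : gens.Finite
  inv_mem : ∀ s ∈ gens, s⁻¹ ∈ gens
  one_notMem : (1 : Γ) ∉ gens
  closure_gens : Subgroup.closure gens = ⊤

/-- The left shift action of `Γ` on `2^Γ`, `(g · x)(h) = x (g⁻¹ h)`. -/
def shift {Γ : Type*} [Group Γ] (g : Γ) (x : Γ → Bool) : Γ → Bool :=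
  fun h => x (g⁻¹ * h)

theorem shift_inv_shift {Γ : Type*} [Group Γ] (g : Γ) (x : Γ → Bool) :
    shift g⁻¹ (shift g x) = x := by
  funext h
  simp [shift]

/-- The free part `F(2^Γ)` of the left shift action. As a subset of `Γ → Bool` it carries the
subspace topology and the σ-algebra induced by the product σ-algebra; see the next instance. -/
def freePart (Γ : Type*) [Group Γ] : Set (Γ → Bool) :=
  {x | ∀ g : Γ, g ≠ 1 → shift g x ≠ x}

/-- For countable `Γ`, the σ-algebra on `F(2^Γ)` is the Borel σ-algebra of its topology. -/
instance freePart_borelSpace (Γ : Type*) [Group Γ] [Countable Γ] : BorelSpace (freePart Γ) :=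
  inferInstance

/-- The shift graph of a marked group: `x` and `y` in `F(2^Γ)` are adjacent
iff `s · x = y` for some generator `s`. -/
def shiftGraph {Γ : Type*} [Group Γ] (S : Marking Γ) : SimpleGraph (freePart Γ) where
  Adj x y := ∃ s ∈ S.gens, shift s (x : Γ → Bool) = y
  symm := ⟨by
    rintro x y ⟨s, hs, h⟩
    exact ⟨s⁻¹, S.inv_mem s hs, by rw [← h, shift_inv_shift]⟩⟩
  loopless := ⟨by
    rintro x ⟨s, hs, h⟩
    exact x.2 s (fun h1 => S.one_notMem (h1 ▸ hs)) h⟩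

/-- The `μ`-measurable chromatic number `χ_μ(G)`: the least `n` such that `G` has a proper
`n`-coloring which is `μ`-measurable, that is, measurable for the `μ`-completion of the σ-algebra
(and `⊤` if there is no such `n`). -/
noncomputable def measurableChromaticNumber {X : Type*} [MeasurableSpace X]
    (G : SimpleGraph X) (μ : Measure X) : ℕ∞ :=
  ⨅ n ∈ {n : ℕ | ∃ c : G.Coloring (Fin n), NullMeasurable (fun x => c x) μ}, (n : ℕ∞)

/-- The measure chromatic number `χ_M(G)`: the supremum of `χ_μ(G)` over all
probability measures `μ` on `X`. -/
noncomputable def measureChromaticNumber {X : Type*} [MeasurableSpace X]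
    (G : SimpleGraph X) : ℕ∞ :=
  ⨆ (μ : Measure X) (_ : IsProbabilityMeasure μ), measurableChromaticNumber G μ

/-- The group `Z_k × Z_k`, written multiplicatively. -/
abbrev Torus (k : ℕ) : Type := Multiplicative (ZMod k × ZMod k)

/-- The set `{(a, b) | a ≠ 0, b ≠ 0}` of generators of `Z_k × Z_k`. -/
def torusGens (k : ℕ) : Set (Torus k) :=
  {v | v.toAdd.1 ≠ 0 ∧ v.toAdd.2 ≠ 0}

/-- The subset `{-1, 0, 1}` of `ℤ`. -/
def steps : Set (Multiplicative ℤ) :=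
  {n | n.toAdd = -1 ∨ n.toAdd = 0 ∨ n.toAdd = 1}

/-- The automorphism `(a, b) ↦ (b, a)` of `Z_k × Z_k`. -/
def swapAut (k : ℕ) : MulAut (Torus k) :=
  AddEquiv.toMultiplicative (AddEquiv.prodComm (M := ZMod k) (N := ZMod k))

/-- The homomorphism `ℤ → Aut(Z_k × Z_k)` which sends `1` to the swap. -/
def swapHom (k : ℕ) : Multiplicative ℤ →* MulAut (Torus k) :=
  zpowersHom (MulAut (Torus k)) (swapAut k)

/-- The underlying group of `Δ_k`: the direct product `(Z_k × Z_k) × ℤ`. -/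
abbrev Delta (k : ℕ) : Type := Torus k × Multiplicative ℤ

/-- The underlying group of `Γ_k`: the semidirect product `(Z_k × Z_k) ⋊ ℤ`
in which `1 ∈ ℤ` acts by swapping the coordinates. -/
abbrev Gamma (k : ℕ) : Type := Torus k ⋊[swapHom k] Multiplicative ℤ

theorem swapHom_one (k : ℕ) : swapHom k (Multiplicative.ofAdd 1) = swapAut k := by
  simp [swapHom]

theorem swapAut_mem_torusGens {k : ℕ} {v : Torus k} (hv : v ∈ torusGens k) :
    swapAut k v ∈ torusGens k :=
  ⟨hv.2, hv.1⟩

theorem swapHom_mem_torusGens {k : ℕ} {n : Multiplicative ℤ} (hn : n ∈ steps)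
    {v : Torus k} (hv : v ∈ torusGens k) : swapHom k n v ∈ torusGens k := by
  have hs : swapAut k * swapAut k = 1 := by ext v <;> rfl
  rcases hn with h | h | h
  · obtain rfl : n = .ofAdd (-1) := h
    rw [ofAdd_neg, map_inv, swapHom_one, inv_eq_of_mul_eq_one_right hs]
    exact swapAut_mem_torusGens hv
  · obtain rfl : n = 1 := h
    simpa using hv
  · obtain rfl : n = .ofAdd 1 := h
    rw [swapHom_one]
    exact swapAut_mem_torusGens hv

theorem inv_mem_torusGens {k : ℕ} {v : Torus k} (hv : v ∈ torusGens k) : v⁻¹ ∈ torusGens k :=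
  ⟨neg_ne_zero.2 hv.1, neg_ne_zero.2 hv.2⟩

theorem inv_mem_steps {n : Multiplicative ℤ} (hn : n ∈ steps) : n⁻¹ ∈ steps := by
  simp only [steps, Set.mem_ofPred_eq, toAdd_inv] at *
  omega

theorem finite_steps : steps.Finite :=
  Set.Finite.subset (s := {.ofAdd (-1), .ofAdd 0, .ofAdd 1}) (by simp) fun _ h => h

theorem finite_torusGens {k : ℕ} (hk : 3 ≤ k) : (torusGens k).Finite := by
  have : NeZero k := ⟨by omega⟩
  have : Finite (Torus k) := inferInstanceAs (Finite (ZMod k × ZMod k))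
  exact Set.toFinite _

theorem closure_torusGens {k : ℕ} (hk : 3 ≤ k) : Subgroup.closure (torusGens k) = ⊤ := by
  have h1 : (1 : ZMod k) ≠ 0 := by
    have : Fact (1 < k) := ⟨by omega⟩
    exact one_ne_zero
  have h2 : (2 : ZMod k) ≠ 0 := by
    intro h
    have : ((2 : ℕ) : ZMod k) = 0 := by exact_mod_cast h
    rw [ZMod.natCast_eq_zero_iff] at this
    exact absurd (Nat.le_of_dvd (by norm_num) this) (by omega)
  have key : ∀ a : ZMod k, ∃ x y : ZMod k, x ≠ 0 ∧ y ≠ 0 ∧ x + y = a := by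
    intro a
    by_cases ha : a = 1
    · exact ⟨2, -1, h2, neg_ne_zero.2 h1, by rw [ha]; ring⟩
    · exact ⟨1, a - 1, h1, sub_ne_zero.2 ha, by ring⟩
  rw [eq_top_iff]
  rintro v -
  obtain ⟨x, y, hx, hy, hxy⟩ := key v.toAdd.1
  obtain ⟨z, w, hz, hw, hzw⟩ := key v.toAdd.2
  have : v = .ofAdd (x, z) * .ofAdd (y, w) := by
    apply Multiplicative.toAdd.injective
    exact Prod.ext hxy.symm hzw.symm
  rw [this]
  exact mul_mem (Subgroup.subset_closure ⟨hx, hz⟩) (Subgroup.subset_closure ⟨hy, hw⟩)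

/-- The marked group `Δ_k = (Z_k × Z_k) × ℤ` with generators `S × {-1, 0, 1}`,
where `S = {(a, b) | a ≠ 0, b ≠ 0}`. -/
def deltaMarking (k : ℕ) (hk : 3 ≤ k) : Marking (Delta k) where
  gens := {g | g.1 ∈ torusGens k ∧ g.2 ∈ steps}
  finite_gens := (finite_torusGens hk).prod finite_steps
  inv_mem := fun _ hs => ⟨inv_mem_torusGens hs.1, inv_mem_steps hs.2⟩
  one_notMem := fun h => h.1.1 rfl
  closure_gens := by
    set H := Subgroup.closure {g : Delta k | g.1 ∈ torusGens k ∧ g.2 ∈ steps} with hH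
    have hT : ∀ v : Torus k, ((v, 1) : Delta k) ∈ H := by
      have : Subgroup.closure (torusGens k) ≤ H.comap (MonoidHom.inl _ _) := by
        rw [Subgroup.closure_le]
        exact fun v hv => Subgroup.subset_closure ⟨hv, Or.inr (Or.inl rfl)⟩
      rw [closure_torusGens hk] at this
      exact fun v => this (Subgroup.mem_top v)
    have hs : ∃ v, v ∈ torusGens k := by
      have : Fact (1 < k) := ⟨by omega⟩
      exact ⟨.ofAdd (1, 1), one_ne_zero, one_ne_zero⟩
    obtain ⟨v, hv⟩ := hs
    have h1 : ((1, .ofAdd 1) : Delta k) ∈ H := by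
      have h : ((v, .ofAdd 1) : Delta k) ∈ H :=
        Subgroup.subset_closure ⟨hv, Or.inr (Or.inr rfl)⟩
      simpa using mul_mem (inv_mem (hT v)) h
    rw [eq_top_iff]
    rintro ⟨w, n⟩ -
    have h := mul_mem (hT w) (zpow_mem h1 n.toAdd)
    have e : ((w, 1) : Delta k) * (1, .ofAdd 1) ^ n.toAdd = (w, n) := by
      ext1
      · simp
      · simp [← ofAdd_zsmul]
    rwa [e] at h

/-- The marked group `Γ_k = (Z_k × Z_k) ⋊ ℤ` with generators `S × {-1, 0, 1}`,
where `S = {(a, b) | a ≠ 0, b ≠ 0}`. -/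
def gammaMarking (k : ℕ) (hk : 3 ≤ k) : Marking (Gamma k) where
  gens := {g | g.left ∈ torusGens k ∧ g.right ∈ steps}
  finite_gens :=
    ((finite_torusGens hk).prod finite_steps).preimage
      (f := fun g : Gamma k => (g.left, g.right))
      (fun a _ b _ h => SemidirectProduct.ext (congrArg Prod.fst h) (congrArg Prod.snd h))
  inv_mem := fun _ hs =>
    ⟨swapHom_mem_torusGens (inv_mem_steps hs.2) (inv_mem_torusGens hs.1), inv_mem_steps hs.2⟩
  one_notMem := fun h => h.1.1 rfl
  closure_gens := by
    set H := Subgroup.closure {g : Gamma k | g.left ∈ torusGens k ∧ g.right ∈ steps} with hH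
    have hT : ∀ v : Torus k, (SemidirectProduct.inl v : Gamma k) ∈ H := by
      have : Subgroup.closure (torusGens k) ≤ H.comap SemidirectProduct.inl := by
        rw [Subgroup.closure_le]
        exact fun v hv => Subgroup.subset_closure ⟨hv, Or.inr (Or.inl rfl)⟩
      rw [closure_torusGens hk] at this
      exact fun v => this (Subgroup.mem_top v)
    have hs : ∃ v, v ∈ torusGens k := by
      have : Fact (1 < k) := ⟨by omega⟩
      exact ⟨.ofAdd (1, 1), one_ne_zero, one_ne_zero⟩
    obtain ⟨v, hv⟩ := hs
    have h1 : (SemidirectProduct.inr (.ofAdd 1) : Gamma k) ∈ H := by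
      have h : (⟨v, .ofAdd 1⟩ : Gamma k) ∈ H :=
        Subgroup.subset_closure ⟨hv, Or.inr (Or.inr rfl)⟩
      rw [SemidirectProduct.mk_eq_inl_mul_inr] at h
      simpa using mul_mem (inv_mem (hT v)) h
    rw [eq_top_iff]
    rintro ⟨w, n⟩ -
    have h := mul_mem (hT w) (zpow_mem h1 n.toAdd)
    rw [← map_zpow, ← ofAdd_zsmul, smul_eq_mul, mul_one, ofAdd_toAdd] at h
    rwa [SemidirectProduct.mk_eq_inl_mul_inr]

end ShiftGraphs

/-! Upper bounds: a Borel maximal set of separated markers cuts every orbit, along its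
`ℤ`-direction, into tiles of bounded length. The fibre `Z_k × Z_k` over each marker gets one fixed
coloring by rows; inside a tile one passes through successively compatible fibre colorings from it
to its translate at the next marker (`exists_measurable_coloring`). In `Δ_k` both ends color by
rows, and one color beyond `k` is enough room to permute row colors (`reflTransGen_rowCompatible`).
In `Γ_k` a tile of odd length swaps the coordinates, so rows must be turned into columns; `2k - 1`
colors allow this through mixed colorings (`reflTransGen_gridCompatible`).

Lower bounds: cells of compatible fibres with equal color share a line. With at most `k` colors,
counting forces neighboring fibres of `Δ_k` to be colored identically (`GridCompatible.eq`). With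
fewer than `2k - 1` colors a fibre has exactly one of two types, row or column; compatible fibres
have the same type, so the swap in `Γ_k` exchanges the types at each step. An irrational rotation
coded into the free part (`exists_rotation_measure`) contradicts both by ergodicity: the coloring
would be a.e. constant despite edges, or a measurable set would be exchanged with its complement
(`not_forall_add_angle_mem_iff`). -/

namespace ShiftGraphs

/-! ### Borel maximal independent sets for the shift action -/

section Action

variable {Γ : Type*} [Group Γ]

theorem shift_one (x : Γ → Bool) : shift 1 x = x := by
  funext h
  simp [shift]

theorem shift_mul (g h : Γ) (x : Γ → Bool) : shift (g * h) x = shift g (shift h x) := by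
  funext u
  simp [shift, mul_assoc]

theorem shift_mem_freePart (g : Γ) {x : Γ → Bool} (hx : x ∈ freePart Γ) :
    shift g x ∈ freePart Γ := by
  intro u hu h
  refine hx (g⁻¹ * u * g) (fun h1 => hu ?_) ?_
  · have : u = g * (g⁻¹ * u * g) * g⁻¹ := by group
    rw [this, h1]
    group
  · rw [shift_mul, shift_mul, h, shift_inv_shift]

/-- The shift action of `Γ` on the free part. -/
instance freePartAction : MulAction Γ (freePart Γ) where
  smul g x := ⟨shift g x, shift_mem_freePart g x.2⟩
  one_smul _ := Subtype.ext (shift_one _)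
  mul_smul g h _ := Subtype.ext (shift_mul g h _)

theorem coe_smul_freePart (g : Γ) (x : freePart Γ) :
    ((g • x : freePart Γ) : Γ → Bool) = shift g (x : Γ → Bool) :=
  rfl

theorem shiftGraph_adj_iff (S : Marking Γ) (x y : freePart Γ) :
    (shiftGraph S).Adj x y ↔ ∃ s ∈ S.gens, s • x = y := by
  simp only [shiftGraph, Subtype.ext_iff, coe_smul_freePart]

theorem measurable_smul_freePart (g : Γ) : Measurable fun x : freePart Γ => g • x := by
  refine Measurable.subtype_mk (measurable_pi_iff.2 fun h => ?_)
  exact (measurable_pi_apply (g⁻¹ * h)).comp measurable_subtype_coe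

/-- The basic clopen set of all points of the free part which on the window `W` agree with the
indicator of `P`. -/
def cylinder (W P : Finset Γ) : Set (freePart Γ) :=
  {x | ∀ h ∈ W, ((x : Γ → Bool) h = true ↔ h ∈ P)}

theorem measurableSet_cylinder (W P : Finset Γ) : MeasurableSet (cylinder W P) := by
  have : cylinder W P = ⋂ h ∈ W, {x : freePart Γ | (x : Γ → Bool) h = true ↔ h ∈ P} := by
    ext x
    simp [cylinder]
  rw [this]
  refine Finset.measurableSet_biInter _ fun h _ => ?_
  have hm : Measurable fun x : freePart Γ => (x : Γ → Bool) h :=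
    (measurable_pi_apply h).comp measurable_subtype_coe
  exact hm (MeasurableSet.of_discrete (s := {b : Bool | b = true ↔ h ∈ P}))

/-- A set is `K`-independent if no nontrivial element of `K` moves one of its points to another. -/
def IsIndependent (K : Set Γ) (U : Set (freePart Γ)) : Prop :=
  ∀ x ∈ U, ∀ g ∈ K, g • x ∈ U → g = 1

/-- Freeness gives each nontrivial `g` a position `w g` at which `x` and `g • x` differ. A window
containing `w g` and `g⁻¹ * w g` for all `g ∈ K` sees this difference for every point of the
cylinder. -/
theorem exists_isIndependent_cylinder {K : Set Γ} (hK : K.Finite) (x : freePart Γ) :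
    ∃ W P : Finset Γ, IsIndependent K (cylinder W P) ∧ x ∈ cylinder W P := by
  classical
  have key : ∀ g : Γ, g ≠ 1 → ∃ h, (x : Γ → Bool) (g⁻¹ * h) ≠ (x : Γ → Bool) h := by
    intro g hg
    by_contra! hne
    exact x.2 g hg (funext hne)
  choose! w hw using key
  set W : Finset Γ := hK.toFinset.image w ∪ hK.toFinset.image fun g => g⁻¹ * w g with hW
  set P : Finset Γ := W.filter fun h => (x : Γ → Bool) h = true with hP
  refine ⟨W, P, ?_, fun h hh => by simp [hP, hh]⟩
  intro y hy g hg hgy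
  by_contra hg1
  have h1 : w g ∈ W := by
    rw [hW]
    exact Finset.mem_union_left _ (Finset.mem_image_of_mem _ (hK.mem_toFinset.2 hg))
  have h2 : g⁻¹ * w g ∈ W := by
    rw [hW]
    exact Finset.mem_union_right _
      (Finset.mem_image_of_mem (fun g => g⁻¹ * w g) (hK.mem_toFinset.2 hg))
  have e1 := hgy _ h1
  have e2 := hy _ h2
  simp only [hP, Finset.mem_filter, h1, h2, true_and] at e1 e2
  rw [coe_smul_freePart, shift, e2] at e1
  exact hw g hg1 (Bool.eq_iff_iff.2 e1)

/-- The greedy construction of a maximal `K`-independent set out of a sequence of sets. -/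
def greedy (K : Set Γ) (U : ℕ → Set (freePart Γ)) : ℕ → Set (freePart Γ)
  | 0 => ∅
  | n + 1 => greedy K U n ∪ {x | x ∈ U n ∧ ∀ g ∈ K, g • x ∉ greedy K U n}

theorem greedy_mono (K : Set Γ) (U : ℕ → Set (freePart Γ)) : Monotone (greedy K U) :=
  monotone_nat_of_le_succ fun _ => Set.subset_union_left

theorem isIndependent_greedy {K : Set Γ} (hinv : ∀ g ∈ K, g⁻¹ ∈ K) {U : ℕ → Set (freePart Γ)}
    (hU : ∀ n, IsIndependent K (U n)) (n : ℕ) : IsIndependent K (greedy K U n) := by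
  induction n with
  | zero => exact fun x hx => hx.elim
  | succ n ih =>
    rintro x (hx | hx) g hg (hgx | hgx)
    · exact ih x hx g hg hgx
    · exact absurd (by simpa using hx) (hgx.2 g⁻¹ (hinv g hg))
    · exact absurd hgx (hx.2 g hg)
    · exact hU n x hx.1 g hg hgx.1

theorem measurableSet_greedy {K : Set Γ} (hK : K.Finite) {U : ℕ → Set (freePart Γ)}
    (hU : ∀ n, MeasurableSet (U n)) (n : ℕ) : MeasurableSet (greedy K U n) := by
  induction n with
  | zero => exact MeasurableSet.empty
  | succ n ih =>
    refine ih.union ?_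
    have : {x | x ∈ U n ∧ ∀ g ∈ K, g • x ∉ greedy K U n} =
        U n ∩ ⋂ g ∈ K, (fun x : freePart Γ => g • x) ⁻¹' (greedy K U n)ᶜ := by
      ext x
      simp
    rw [this]
    exact (hU n).inter
      (hK.measurableSet_biInter fun g _ => measurable_smul_freePart g ih.compl)

/-- Existence of a Borel maximal `K`-independent set. -/
theorem exists_maximal_isIndependent [Countable Γ] {K : Set Γ} (hK : K.Finite)
    (hone : (1 : Γ) ∈ K) (hinv : ∀ g ∈ K, g⁻¹ ∈ K) :
    ∃ M : Set (freePart Γ), MeasurableSet M ∧ IsIndependent K M ∧ ∀ x, ∃ g ∈ K, g • x ∈ M := by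
  classical
  obtain ⟨e, he⟩ := exists_surjective_nat (Finset Γ × Finset Γ)
  set U : ℕ → Set (freePart Γ) := fun n =>
    if IsIndependent K (cylinder (e n).1 (e n).2) then cylinder (e n).1 (e n).2 else ∅ with hUdef
  have hUm : ∀ n, MeasurableSet (U n) := by
    intro n
    simp only [hUdef]
    split_ifs
    · exact measurableSet_cylinder _ _
    · exact MeasurableSet.empty
  have hUi : ∀ n, IsIndependent K (U n) := by
    intro n
    simp only [hUdef]
    split_ifs with h
    · exact h
    · exact fun x hx => hx.elim
  refine ⟨⋃ n, greedy K U n, MeasurableSet.iUnion (measurableSet_greedy hK hUm), ?_, ?_⟩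
  · intro x hx g hg hgx
    obtain ⟨m, hm⟩ := Set.mem_iUnion.1 hx
    obtain ⟨n, hn⟩ := Set.mem_iUnion.1 hgx
    exact isIndependent_greedy hinv hUi (max m n) x (greedy_mono K U (le_max_left _ _) hm) g hg
      (greedy_mono K U (le_max_right _ _) hn)
  · intro x
    obtain ⟨W, P, hi, hx⟩ := exists_isIndependent_cylinder hK x
    obtain ⟨n, hn⟩ := he (W, P)
    have hxU : x ∈ U n := by
      simp only [hUdef, hn]
      rw [if_pos hi]
      exact hx
    -- Either `x` is added at stage `n + 1`, or a `K`-translate of it was already chosen.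
    by_cases h : ∀ g ∈ K, g • x ∉ greedy K U n
    · exact ⟨1, hone, Set.mem_iUnion.2 ⟨n + 1, by rw [one_smul]; exact Or.inr ⟨hxU, h⟩⟩⟩
    · push Not at h
      obtain ⟨g, hg, hgx⟩ := h
      exact ⟨g, hg, Set.mem_iUnion.2 ⟨n, hgx⟩⟩

end Action

/-! ### Tiling orbits between consecutive markers -/

section Tiling

variable {Γ : Type*} [Group Γ] (π : Γ →* Multiplicative ℤ)

/-- The integer value of a homomorphism to `ℤ`. -/
def level (g : Γ) : ℤ := (π g).toAdd

@[simp] theorem level_one : level π (1 : Γ) = 0 := by simp [level]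

@[simp] theorem level_mul (g h : Γ) : level π (g * h) = level π g + level π h := by simp [level]

@[simp] theorem level_inv (g : Γ) : level π g⁻¹ = -level π g := by simp [level]

/-- `x` is the translate by `h` of a marker whose next marker is its translate by `g`. -/
def IsTiled (M : Set (freePart Γ)) (L : ℤ) (x : freePart Γ) (h g : Γ) : Prop :=
  h⁻¹ • x ∈ M ∧ g • h⁻¹ • x ∈ M ∧ 0 ≤ level π h ∧ level π h < level π g ∧
    L < level π g ∧ level π g ≤ 2 * L + 1

variable {π} {M : Set (freePart Γ)} {L : ℤ}

theorem measurableSet_isTiled (hM : MeasurableSet M) (h g : Γ) :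
    MeasurableSet {x | IsTiled π M L x h g} := by
  have h1 : MeasurableSet {x : freePart Γ | h⁻¹ • x ∈ M} := measurable_smul_freePart h⁻¹ hM
  have h2 : MeasurableSet {x : freePart Γ | g • h⁻¹ • x ∈ M} :=
    (measurable_smul_freePart g).comp (measurable_smul_freePart h⁻¹) hM
  exact h1.inter (h2.inter (MeasurableSet.const _))

theorem IsTiled.eq_of_le (hM : IsIndependent {g | |level π g| ≤ L} M) {x : freePart Γ}
    {h g h' g' : Γ} (H : IsTiled π M L x h g) (H' : IsTiled π M L x h' g')
    (hle : level π h' ≤ level π h) : h = h' ∧ g = g' := by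
  obtain ⟨a1, a2, a3, a4, a5, a6⟩ := H
  obtain ⟨b1, b2, b3, b4, b5, b6⟩ := H'
  by_cases hd : level π h - level π h' ≤ L
  · have e : h'⁻¹ * h = 1 := by
      refine hM _ a1 _ ?_ (by simpa [mul_smul] using b1)
      simp only [Set.mem_ofPred_eq, level_mul, level_inv, abs_le]
      omega
    obtain rfl : h' = h := inv_mul_eq_one.1 e
    refine ⟨rfl, ?_⟩
    -- Two next markers of one marker have levels in `(L, 2L + 1]`, hence at distance at most `L`.
    have e : g' * g⁻¹ = 1 := by
      refine hM _ a2 _ ?_ (by simpa [mul_smul] using b2)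
      simp only [Set.mem_ofPred_eq, level_mul, level_inv, abs_le]
      omega
    exact (mul_inv_eq_one.1 e).symm
  -- The upper end of the first tile lies strictly above `x`, the lower end of the second at or
  -- below `x`. Here their distance is positive and at most `L`, against independence.
  · exfalso
    have e : g * (h'⁻¹ * h)⁻¹ = 1 := by
      refine hM _ b1 _ ?_ (by simpa [mul_smul] using a2)
      simp only [Set.mem_ofPred_eq, level_mul, level_inv, abs_le]
      omega
    have := congrArg (level π) e
    simp only [level_mul, level_inv, level_one] at this
    omega

theorem IsTiled.unique (hM : IsIndependent {g | |level π g| ≤ L} M) {x : freePart Γ}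
    {h g h' g' : Γ} (H : IsTiled π M L x h g) (H' : IsTiled π M L x h' g') :
    h = h' ∧ g = g' := by
  rcases le_total (level π h') (level π h) with hle | hle
  · exact H.eq_of_le hM H' hle
  · obtain ⟨e1, e2⟩ := H'.eq_of_le hM H hle
    exact ⟨e1.symm, e2.symm⟩

theorem exists_next_marker (hM : IsIndependent {g | |level π g| ≤ L} M)
    (hmax : ∀ x, ∃ g ∈ {g | |level π g| ≤ L}, g • x ∈ M) (hL : 0 ≤ L) {t : Γ}
    (ht : level π t = L + 1) {x : freePart Γ} (hx : x ∈ M) :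
    ∃ g, g • x ∈ M ∧ L < level π g ∧ level π g ≤ 2 * L + 1 := by
  -- A marker within `L` of level `L + 1` has level in `[1, 2L + 1]`; independence from `x` excludes
  -- `[1, L]`.
  obtain ⟨g, hg, hgx⟩ := hmax (t • x)
  simp only [Set.mem_ofPred_eq, abs_le] at hg
  refine ⟨g * t, by rwa [mul_smul], ?_, by rw [level_mul]; omega⟩
  by_contra hlt
  have e : g * t = 1 := by
    refine hM x hx _ ?_ (by rwa [mul_smul])
    simp only [Set.mem_ofPred_eq, level_mul, abs_le] at hlt ⊢
    omega
  have := congrArg (level π) e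
  simp only [level_mul, level_one] at this
  omega

theorem exists_isTiled (hM : IsIndependent {g | |level π g| ≤ L} M)
    (hmax : ∀ x, ∃ g ∈ {g | |level π g| ≤ L}, g • x ∈ M) (hL : 0 ≤ L) {t : Γ}
    (ht : level π t = L + 1) {r : Γ} (hr : level π r = L) (x : freePart Γ) :
    ∃ h g, IsTiled π M L x h g := by
  -- Searching around level `-L` yields a marker at level in `[-2L, 0]` relative to `x`. Steps to
  -- next markers exceed `L`, so at most two of them pass `x`.
  obtain ⟨u, hu, hux⟩ := hmax (r⁻¹ • x)
  simp only [Set.mem_ofPred_eq, abs_le] at hu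
  rw [← mul_smul] at hux
  obtain ⟨g, hg, hg1, hg2⟩ := exists_next_marker hM hmax hL ht hux
  have hlev : level π (u * r⁻¹) = level π u - L := by simp [hr, sub_eq_add_neg]
  by_cases hpos : 0 < level π g + level π (u * r⁻¹)
  · refine ⟨(u * r⁻¹)⁻¹, g, ?_, ?_, ?_, ?_, hg1, hg2⟩
    · rwa [inv_inv]
    · rwa [inv_inv]
    · rw [level_inv]; omega
    · rw [level_inv]; omega
  · obtain ⟨g', hg', hg1', hg2'⟩ := exists_next_marker hM hmax hL ht hg
    rw [← mul_smul g] at hg'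
    refine ⟨(g * (u * r⁻¹))⁻¹, g', ?_, ?_, ?_, ?_, hg1', hg2'⟩
    · rwa [inv_inv, mul_smul]
    · rwa [inv_inv]
    · rw [level_inv, level_mul]; omega
    · rw [level_inv, level_mul]; omega

/-- Let `Γ` be an extension of `ℤ` by a finite group whose generators have levels `-1`, `0`, `1`.
Suppose that for every `g` of level larger than `L` the coloring `σ` of the kernel can be transported
to its right translate by `g` through a proper coloring of the left Cayley graph. Then the shift
graph has a Borel coloring with the same colors. -/
theorem exists_measurable_coloring [Countable Γ] (S : Marking Γ)
    (hS : ∀ s ∈ S.gens, |level π s| ≤ 1) (hπ : Function.Surjective π)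
    (hfin : ∀ L, {g | |level π g| ≤ L}.Finite) (hL : 0 ≤ L)
    {C : Type*} (σ : Γ → C) (P : Γ → Γ → C)
    (hP : ∀ g, L < level π g → ∀ s ∈ S.gens, ∀ h, P g h ≠ P g (s * h))
    (hP0 : ∀ g, L < level π g → ∀ h, level π h = 0 → P g h = σ h)
    (hPg : ∀ g, L < level π g → ∀ h, level π h = 0 → P g (h * g) = σ h) :
    ∃ c : (shiftGraph S).Coloring C, ∀ d, MeasurableSet (c ⁻¹' {d}) := by
  obtain ⟨M, hMm, hM, hmax⟩ := exists_maximal_isIndependent (hfin L) (by simpa using hL)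
    (fun g hg => by simpa using hg)
  obtain ⟨t, ht⟩ := hπ (.ofAdd (L + 1))
  obtain ⟨r, hr⟩ := hπ (.ofAdd L)
  have ht : level π t = L + 1 := by simp [level, ht]
  have hr : level π r = L := by simp [level, hr]
  choose h g hhg using exists_isTiled hM hmax hL ht hr
  set c : freePart Γ → C := fun x => P (g x) (h x) with hc
  have hcol : ∀ {x h' g'}, IsTiled π M L x h' g' → c x = P g' h' := by
    intro x h' g' H
    obtain ⟨e1, e2⟩ := (hhg x).unique hM H
    rw [hc, ← e1, ← e2]
  have step : ∀ s ∈ S.gens, 0 ≤ level π s → ∀ x, c x ≠ c (s • x) := by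
    intro s hs hs0 x
    have hs1 := (abs_le.1 (hS s hs)).2
    obtain ⟨a1, a2, a3, a4, a5, a6⟩ := hhg x
    by_cases hlt : level π (s * h x) < level π (g x)
    · have H : IsTiled π M L (s • x) (s * h x) (g x) := by
        refine ⟨?_, ?_, ?_, hlt, a5, a6⟩
        · simpa [mul_smul] using a1
        · simpa [mul_smul] using a2
        · rw [level_mul]; omega
      rw [hcol H]
      exact hP _ a5 s hs _
    -- As levels change by at most one, `s • x` lies in the fibre of the next marker. There the new
    -- tile has color `σ`, which by `hPg` is also what the old tile prescribes, so properness within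
    -- the old tile applies.
    · rw [level_mul] at hlt
      obtain ⟨g', hg', hg1', hg2'⟩ := exists_next_marker hM hmax hL ht a2
      have h0 : level π (s * h x * (g x)⁻¹) = 0 := by
        rw [level_mul, level_mul, level_inv]; omega
      have H : IsTiled π M L (s • x) (s * h x * (g x)⁻¹) g' := by
        refine ⟨?_, ?_, h0.ge, by omega, hg1', hg2'⟩
        · simpa [mul_smul] using a2
        · simpa [mul_smul] using hg'
      rw [hcol H, hP0 _ hg1' _ h0, ← hPg _ a5 _ h0]
      simpa using hP _ a5 s hs (h x)
  refine ⟨SimpleGraph.Coloring.mk c ?_, ?_⟩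
  · intro x y hxy
    obtain ⟨s, hs, rfl⟩ := (shiftGraph_adj_iff S x y).1 hxy
    by_cases hs0 : 0 ≤ level π s
    · exact step s hs hs0 x
    · have := step s⁻¹ (S.inv_mem s hs) (by rw [level_inv]; omega) (s • x)
      rw [inv_smul_smul] at this
      exact this.symm
  · intro d
    have : c ⁻¹' {d} = ⋃ (h') (g') (_ : P g' h' = d), {x | IsTiled π M L x h' g'} := by
      ext x
      simp only [Set.mem_preimage, Set.mem_singleton_iff, Set.mem_iUnion, Set.mem_ofPred_eq,
        exists_prop]
      constructor
      · exact fun hx => ⟨h x, g x, hx, hhg x⟩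
      · rintro ⟨h', g', hd, H⟩
        rw [hcol H, hd]
    change MeasurableSet (c ⁻¹' {d})
    rw [this]
    exact .iUnion fun h' => .iUnion fun g' => .iUnion fun _ => measurableSet_isTiled hMm h' g'

end Tiling

/-! ### Criteria for bounding the measure chromatic number -/

section ChromaticNumber

variable {X : Type*} [MeasurableSpace X] {G : SimpleGraph X}

/-- A Borel coloring bounds the measure chromatic number. -/
theorem measureChromaticNumber_le {C : Type*} [Fintype C] {n : ℕ} (hn : Fintype.card C = n)
    (c : G.Coloring C) (hc : ∀ d, MeasurableSet (c ⁻¹' {d})) :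
    measureChromaticNumber G ≤ n := by
  refine iSup₂_le fun μ _ => ?_
  set e := Fintype.equivFinOfCardEq hn
  have hm : Measurable fun x => e (c x) := by
    refine measurable_to_countable' fun i => ?_
    convert hc (e.symm i) using 1
    ext x
    simp [Equiv.eq_symm_apply]
  exact iInf₂_le_of_le n
    ⟨SimpleGraph.Coloring.mk (fun x => e (c x)) fun h => fun he => c.valid h (e.injective he),
      hm.nullMeasurable⟩ le_rfl

/-- If for a probability measure `μ` there is no `μ`-measurable coloring with fewer than `n`
colors, then the measure chromatic number is at least `n`. -/
theorem le_measureChromaticNumber {n : ℕ} (μ : Measure X) [IsProbabilityMeasure μ]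
    (h : ∀ m < n, ∀ c : G.Coloring (Fin m), ¬ NullMeasurable (fun x => c x) μ) :
    (n : ℕ∞) ≤ measureChromaticNumber G := by
  refine le_iSup₂_of_le μ ‹_› (le_iInf₂ ?_)
  rintro m ⟨c, hc⟩
  by_contra hlt
  exact h m (by exact_mod_cast not_le.1 hlt) c hc

end ChromaticNumber

/-! ### Combinatorics of compatible grid colorings -/

section Grid

variable {α C : Type*}

/-- Two colorings of the grid `α × α` are compatible if a common color only ever appears at cells
which lie on a common row or column. -/
def GridCompatible (G H : α × α → C) : Prop :=
  ∀ v w, v.1 ≠ w.1 → v.2 ≠ w.2 → G v ≠ H w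

/-- Every row has a repeated color. -/
def RowType (G : α × α → C) : Prop :=
  ∀ i, ∃ j j', j ≠ j' ∧ G (i, j) = G (i, j')

theorem GridCompatible.symm {G H : α × α → C} (h : GridCompatible G H) : GridCompatible H G :=
  fun v w h1 h2 e => h w v h1.symm h2.symm e.symm

theorem GridCompatible.comp_swap {G H : α × α → C} (h : GridCompatible G H) :
    GridCompatible (G ∘ Prod.swap) (H ∘ Prod.swap) :=
  fun v w h1 h2 => h v.swap w.swap h2 h1

theorem GridCompatible.eq_or {G H : α × α → C} (h : GridCompatible G H) {i j i' j' : α}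
    (e : G (i, j) = H (i', j')) : i = i' ∨ j = j' := by
  by_contra! hne
  exact h _ _ hne.1 hne.2 e

/-- With fewer than `2|α| - 1` colors, all rows or all columns have a repeated color. -/
theorem rowType_or_rowType_comp_swap [Fintype α] [Fintype C] {G : α × α → C}
    (hG : GridCompatible G G) (hC : Fintype.card C + 1 < 2 * Fintype.card α) :
    RowType G ∨ RowType (G ∘ Prod.swap) := by
  classical
  by_contra! hne
  simp only [RowType, not_forall, not_exists, not_and] at hne
  obtain ⟨⟨i, hi⟩, ⟨j, hj⟩⟩ := hne
  -- A row and a column without repetitions form a cross of `2|α| - 1` cells with distinct colors.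
  let f : α ⊕ {i' // i' ≠ i} → C := Sum.elim (fun j' => G (i, j')) (fun i' => G (i', j))
  have hf : Function.Injective f := by
    have hmix : ∀ (a : α) (b : {i' // i' ≠ i}), G (i, a) ≠ G (b, j) := by
      rintro a ⟨b, hb⟩ e
      rcases hG.eq_or e with h | h
      · exact hb h.symm
      · subst h
        exact hj i b hb.symm e
    rintro (a | a) (b | b) e
    · by_contra hab
      exact hi a b (fun h => hab (congrArg _ h)) e
    · exact (hmix a b e).elim
    · exact (hmix b a e.symm).elim
    · by_contra hab
      exact hj a b (fun h => hab (congrArg _ (Subtype.ext h))) e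
  have := Fintype.card_le_of_injective f hf
  rw [Fintype.card_sum, Fintype.card_subtype_compl, Fintype.card_subtype_eq] at this
  omega

/-- With fewer than `2|α|` colors, compatible colorings cannot have opposite types. -/
theorem RowType.not_rowType_comp_swap [Fintype α] [Fintype C] {G H : α × α → C}
    (hG : GridCompatible G G) (hH : GridCompatible H H) (hGH : GridCompatible G H)
    (hC : Fintype.card C < 2 * Fintype.card α) (h : RowType G) :
    ¬ RowType (H ∘ Prod.swap) := by
  intro h'
  choose a b hab ha using h
  choose p q hpq hp using h'
  simp only [Function.comp, Prod.swap_prod_mk] at hp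
  -- A color repeated in a row is confined to that row, and one repeated in a column to that column.
  -- No color can be both, so the `2|α|` repeated colors are distinct.
  let f : α ⊕ α → C := Sum.elim (fun i => G (i, a i)) (fun j => H (p j, j))
  have hf : Function.Injective f := by
    have hmix : ∀ i j, G (i, a i) ≠ H (p j, j) := by
      intro i j e
      have e1 := hGH.eq_or e
      have e2 := hGH.eq_or ((ha i).symm.trans e)
      have e3 := hGH.eq_or (e.trans (hp j))
      have e4 := hGH.eq_or ((ha i).symm.trans (e.trans (hp j)))
      have := hab i
      have := hpq j
      grind
    rintro (i | i) (j | j) e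
    · have e : G (i, a i) = G (j, a j) := e
      by_contra hij
      have e1 := hG.eq_or e
      have e2 := hG.eq_or ((ha i).symm.trans e)
      have := hab i
      grind
    · exact (hmix i j e).elim
    · exact (hmix j i e.symm).elim
    · have e : H (p i, i) = H (p j, j) := e
      by_contra hij
      have e1 := hH.eq_or e
      have e2 := hH.eq_or ((hp i).symm.trans e)
      have := hpq i
      grind
  have := Fintype.card_le_of_injective f hf
  rw [Fintype.card_sum] at this
  omega

/-- A set of cells any two of which lie on a common line is contained in a line. -/
theorem subset_row_or_column {D : Set (α × α)} (v : α × α) (hv : v ∈ D)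
    (hD : ∀ v ∈ D, ∀ w ∈ D, v.1 = w.1 ∨ v.2 = w.2) :
    (∀ w ∈ D, w.1 = v.1) ∨ ∀ w ∈ D, w.2 = v.2 := by
  by_contra! h
  obtain ⟨⟨w, hw, hw1⟩, ⟨u, hu, hu2⟩⟩ := h
  have h1 := hD v hv w hw
  have h2 := hD v hv u hu
  have h3 := hD w hw u hu
  grind

/-- With at most `|α|` colors, compatible colorings are equal. -/
theorem GridCompatible.eq [Fintype α] [Fintype C] {G H : α × α → C}
    (hG : GridCompatible G G) (hH : GridCompatible H H) (hGH : GridCompatible G H)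
    (hC : Fintype.card C ≤ Fintype.card α) : G = H := by
  classical
  -- The cells given color `d` by `G` or `H` lie in one line, so there are at most `|α|` of them.
  -- Since `|α|²` cells share at most `|α|` colors, each class of `G` already fills `D d`.
  set D : C → Set (α × α) := fun d => {v | G v = d ∨ H v = d} with hDdef
  have hD : ∀ d, ∀ v ∈ D d, ∀ w ∈ D d, v.1 = w.1 ∨ v.2 = w.2 := by
    rintro d ⟨i, j⟩ (hv | hv) ⟨i', j'⟩ (hw | hw)
    · exact hG.eq_or (hv.trans hw.symm)
    · exact hGH.eq_or (hv.trans hw.symm)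
    · exact hGH.symm.eq_or (hv.trans hw.symm)
    · exact hH.eq_or (hv.trans hw.symm)
  have hcard : ∀ d, (Finset.univ.filter fun v => v ∈ D d).card ≤ Fintype.card α := by
    intro d
    by_cases hne : ∃ v, v ∈ D d
    · obtain ⟨v, hv⟩ := hne
      rcases subset_row_or_column v hv (hD d) with h | h
      · refine Finset.card_le_card_of_injOn Prod.snd (fun _ _ => Finset.mem_univ _) ?_
        intro x hx y hy e
        simp only [Finset.coe_filter, Finset.mem_univ, true_and, Set.mem_ofPred_eq] at hx hy
        exact Prod.ext ((h x hx).trans (h y hy).symm) e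
      · refine Finset.card_le_card_of_injOn Prod.fst (fun _ _ => Finset.mem_univ _) ?_
        intro x hx y hy e
        simp only [Finset.coe_filter, Finset.mem_univ, true_and, Set.mem_ofPred_eq] at hx hy
        exact Prod.ext e ((h x hx).trans (h y hy).symm)
    · push Not at hne
      rw [Finset.filter_false_of_mem fun v _ => hne v]
      simp
  have hGc : ∀ K : α × α → C, ∑ d, (Finset.univ.filter fun v => K v = d).card =
      Fintype.card α * Fintype.card α := by
    intro K
    refine (Finset.card_eq_sum_card_fiberwise (f := K) (s := Finset.univ) (t := Finset.univ)
      fun _ _ => Finset.mem_univ _).symm.trans ?_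
    rw [Finset.card_univ, Fintype.card_prod]
  have hfull : ∀ K : α × α → C, (∀ v, v ∈ D (K v)) → ∀ d,
      (Finset.univ.filter fun v => K v = d) = Finset.univ.filter fun v => v ∈ D d := by
    intro K hK d
    have hsub : ∀ d, (Finset.univ.filter fun v => K v = d) ⊆
        Finset.univ.filter fun v => v ∈ D d := by
      intro d v hv
      simp only [Finset.mem_filter, Finset.mem_univ, true_and] at hv ⊢
      exact hv ▸ hK v
    refine Finset.eq_of_subset_of_card_le (hsub d) ?_
    by_contra! hlt
    have h1 : ∑ d, (Finset.univ.filter fun v => K v = d).card <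
        ∑ _d : C, Fintype.card α := by
      refine Finset.sum_lt_sum (fun d _ => (Finset.card_le_card (hsub d)).trans (hcard d))
        ⟨d, Finset.mem_univ _, hlt.trans_le (hcard d)⟩
    rw [hGc K, Finset.sum_const, Finset.card_univ, smul_eq_mul] at h1
    exact absurd (Nat.mul_le_mul_right (Fintype.card α) hC) (not_le.2 h1)
  funext v
  have h1 : v ∈ Finset.univ.filter fun w => w ∈ D (H v) := by simp [hDdef]
  rw [← hfull G (fun v => Or.inl rfl) (H v)] at h1
  simpa using h1

end Grid

/-! ### Eventually constant paths -/

section Paths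

variable {A : Type*} {R : A → A → Prop}

/-- A chain for a reflexive relation gives an infinite path which is eventually constant. -/
theorem exists_path_of_reflTransGen (hR : ∀ a, R a a) {a b : A}
    (h : Relation.ReflTransGen R a b) :
    ∃ (f : ℕ → A) (N : ℕ), f 0 = a ∧ (∀ n, R (f n) (f (n + 1))) ∧ ∀ n, N ≤ n → f n = b := by
  induction h using Relation.ReflTransGen.head_induction_on with
  | refl => exact ⟨fun _ => b, 0, rfl, fun _ => hR b, fun _ _ => rfl⟩
  | @head x y h1 _ ih =>
    obtain ⟨f, N, h0, hf, hN⟩ := ih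
    refine ⟨fun n => Nat.casesOn n x f, N + 1, rfl, ?_, ?_⟩
    · rintro (_ | n)
      · simpa [h0] using h1
      · exact hf n
    · rintro (_ | n) hn
      · omega
      · exact hN n (by omega)

/-- For finitely many targets the paths of `exists_path_of_reflTransGen` have a common length. -/
theorem exists_paths_of_reflTransGen {ι : Type*} [Finite ι] (hR : ∀ a, R a a) {a : A} {b : ι → A}
    (h : ∀ i, Relation.ReflTransGen R a (b i)) :
    ∃ (f : ι → ℕ → A) (N : ℕ), ∀ i, f i 0 = a ∧ (∀ n, R (f i n) (f i (n + 1))) ∧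
      ∀ n, N ≤ n → f i n = b i := by
  have := Fintype.ofFinite ι
  choose f N hf using fun i => exists_path_of_reflTransGen hR (h i)
  refine ⟨f, Finset.univ.sup N, fun i => ⟨(hf i).1, (hf i).2.1, fun n hn => (hf i).2.2 n ?_⟩⟩
  exact (Finset.le_sup (f := N) (Finset.mem_univ i)).trans hn

end Paths

theorem abs_le_one_of_mem_steps {n : Multiplicative ℤ} (hn : n ∈ steps) : |n.toAdd| ≤ 1 := by
  rcases hn with h | h | h <;> rw [h] <;> simp

/-- Along a path for a reflexive symmetric relation, neighboring points are related. -/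
theorem path_rel {A : Type*} {R : A → A → Prop} (hR : ∀ a, R a a) (hsymm : ∀ a b, R a b → R b a)
    {f : ℕ → A} (hf : ∀ n, R (f n) (f (n + 1))) {m n : ℤ} (h : |m| ≤ 1) :
    R (f n.toNat) (f (m + n).toNat) := by
  rw [abs_le] at h
  have : (m + n).toNat = n.toNat ∨ (m + n).toNat = n.toNat + 1 ∨ n.toNat = (m + n).toNat + 1 := by
    omega
  rcases this with e | e | e
  · rw [e]
    exact hR _
  · rw [e]
    exact hf _
  · rw [e]
    exact hsymm _ _ (hf _)

/-! ### Upper bound for the direct product -/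

section Delta

/-- Two permutations of `Option α`, seen as injective colorings of the rows `α`, are compatible if
a common color is only given to the same row. -/
def RowCompatible {α : Type*} (τ τ' : Equiv.Perm (Option α)) : Prop :=
  ∀ a b, a ≠ b → τ (some a) ≠ τ' (some b)

theorem rowCompatible_refl {α : Type*} (τ : Equiv.Perm (Option α)) : RowCompatible τ τ :=
  fun _ _ h e => h (Option.some_injective _ (τ.injective e))

theorem RowCompatible.symm {α : Type*} {τ τ' : Equiv.Perm (Option α)} (h : RowCompatible τ τ') :
    RowCompatible τ' τ :=
  fun a b hab e => h b a hab.symm e.symm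

/-- The value at `none` is the spare color; the move gives it to row `c` and leaves the other rows
alone. -/
theorem rowCompatible_mul_swap {α : Type*} [DecidableEq α] (τ : Equiv.Perm (Option α)) (c : α) :
    RowCompatible τ (τ * Equiv.swap none (some c)) := by
  intro a b hab e
  rw [Equiv.Perm.mul_apply, τ.injective.eq_iff] at e
  by_cases hb : b = c
  · subst hb
    simp at e
  · rw [Equiv.swap_apply_of_ne_of_ne (by simp) (by simpa using hb)] at e
    exact hab (Option.some_injective _ e)

/-- With one spare color, any two injective row colorings are joined by a path. -/
theorem reflTransGen_rowCompatible {α : Type*} [Finite α] (τ : Equiv.Perm (Option α)) :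
    Relation.ReflTransGen RowCompatible 1 τ := by
  classical
  have star : ∀ (f : Equiv.Perm (Option α)) (x y : Option α), x ≠ y →
      Relation.ReflTransGen RowCompatible f (f * Equiv.swap x y) := by
    rintro f (_ | a) (_ | b) hab
    · exact absurd rfl hab
    · exact .single (rowCompatible_mul_swap f b)
    · rw [Equiv.swap_comm]
      exact .single (rowCompatible_mul_swap f a)
    · have e : Equiv.swap (some a) (some b) =
          Equiv.swap none (some a) * Equiv.swap none (some b) * Equiv.swap none (some a) := by
        rw [Equiv.swap_comm none (some b)]
        exact (Equiv.swap_mul_swap_mul_swap (by simp) hab.symm).symm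
      rw [e, ← mul_assoc, ← mul_assoc]
      exact .tail (.tail (.single (rowCompatible_mul_swap f a)) (rowCompatible_mul_swap _ b))
        (rowCompatible_mul_swap _ a)
  refine Equiv.Perm.swap_induction_on' (motive := Relation.ReflTransGen RowCompatible 1) τ .refl ?_
  exact fun f x y hxy hf => hf.trans (star f x y hxy)

/-- The upper bound for `Δ_k`. -/
theorem delta_le (k : ℕ) (hk : 3 ≤ k) :
    measureChromaticNumber (shiftGraph (deltaMarking k hk)) ≤ ((k + 1 : ℕ) : ℕ∞) := by
  have : NeZero k := ⟨by omega⟩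
  have : Finite (Torus k) := inferInstanceAs (Finite (ZMod k × ZMod k))
  have : Countable (Multiplicative ℤ) := inferInstanceAs (Countable ℤ)
  -- Right translation by `g` shifts the row index by `u = g.1.toAdd.1`; subtracting `u` undoes
  -- this.
  let b : ZMod k → Equiv.Perm (Option (ZMod k)) := fun u => Equiv.optionCongr (Equiv.subRight u)
  obtain ⟨f, N, hf⟩ := exists_paths_of_reflTransGen (R := RowCompatible) rowCompatible_refl
    (a := 1) (b := b) fun u => reflTransGen_rowCompatible _
  let π : Delta k →* Multiplicative ℤ := MonoidHom.snd _ _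
  have hlev : ∀ g : Delta k, level π g = g.2.toAdd := fun _ => rfl
  obtain ⟨c, hc⟩ := exists_measurable_coloring (π := π) (deltaMarking k hk) (L := N)
    (fun s hs => abs_le_one_of_mem_steps hs.2) (fun n => ⟨(1, n), rfl⟩)
    (fun L => by
      refine ((Set.finite_univ (α := Torus k)).prod
        ((Set.finite_Icc (-L) L).preimage Multiplicative.toAdd.injective.injOn)).subset ?_
      intro g hg
      exact ⟨Set.mem_univ _, abs_le.1 hg⟩)
    (Int.natCast_nonneg N)
    (σ := fun h => some h.1.toAdd.1)
    (P := fun g h => f g.1.toAdd.1 h.2.toAdd.toNat (some h.1.toAdd.1))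
    (by
      intro g _ s hs h
      refine path_rel (R := RowCompatible) rowCompatible_refl (fun _ _ => RowCompatible.symm)
        (hf _).2.1 (abs_le_one_of_mem_steps hs.2) _ _ ?_
      intro e
      exact hs.1.1 (by simpa using e))
    (by
      intro g _ h h0
      rw [hlev] at h0
      simp only [h0, Int.toNat_zero, (hf _).1]
      rfl)
    (by
      intro g hg h h0
      rw [hlev] at h0 hg
      have : (h * g).2.toAdd = g.2.toAdd := by simp [h0]
      simp only [this]
      rw [(hf _).2.2 _ (by omega)]
      simp [b])
  refine measureChromaticNumber_le ?_ c hc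
  simp [ZMod.card]

end Delta

/-! ### Upper bound for the semidirect product -/

section Gamma

variable {α : Type*}

/-- The grid coloring in which a cell in a column `j ≠ z` has color `j`, and the column `z` is
colored by `τ`. -/
def mixedColoring [DecidableEq α] (z : α) (τ : α → α) (v : α × α) : α ⊕ {j : α // j ≠ z} :=
  if h : v.2 = z then .inl (τ v.1) else .inr ⟨v.2, h⟩

/-- The `inl` colors live only in column `z` and each `inr` color only in its own column, so column
`z` may be recolored arbitrarily in one step. -/
theorem gridCompatible_mixed [DecidableEq α] (z : α) (τ τ' : α → α) :
    GridCompatible (mixedColoring z τ) (mixedColoring z τ') := by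
  rintro ⟨a, b⟩ ⟨a', b'⟩ h1 h2
  simp only [mixedColoring]
  split_ifs <;> grind

/-- The coloring of the grid which colors the `i`-th row by `τ i`. -/
def rowColoring (z : α) (τ : α → α) (v : α × α) : α ⊕ {j : α // j ≠ z} :=
  .inl (τ v.1)

/-- The coloring of the grid which colors the `j`-th column by `τ j`. -/
def columnColoring (z : α) (τ : α → α) (v : α × α) : α ⊕ {j : α // j ≠ z} :=
  .inl (τ v.2)

theorem gridCompatible_row (z : α) {τ : α → α} (hτ : Function.Injective τ) :
    GridCompatible (rowColoring z τ) (rowColoring z τ) :=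
  fun _ _ h1 _ e => h1 (hτ (Sum.inl_injective e))

theorem gridCompatible_column (z : α) {τ : α → α} (hτ : Function.Injective τ) :
    GridCompatible (columnColoring z τ) (columnColoring z τ) :=
  fun _ _ _ h2 e => h2 (hτ (Sum.inl_injective e))

theorem gridCompatible_row_mixed [DecidableEq α] (z : α) {τ : α → α} (hτ : Function.Injective τ) :
    GridCompatible (rowColoring z τ) (mixedColoring z τ) := by
  rintro ⟨a, b⟩ ⟨a', b'⟩ h1 h2
  have := hτ.ne h1
  simp only [mixedColoring, rowColoring]
  split_ifs <;> grind

/-- The only common color is `τ z`, used by both in column `z` alone. -/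
theorem gridCompatible_mixed_column [DecidableEq α] (z : α) {τ : α → α} (hτ : Function.Injective τ) :
    GridCompatible (mixedColoring z fun _ => τ z) (columnColoring z τ) := by
  rintro ⟨a, b⟩ ⟨a', b'⟩ h1 h2
  have := hτ.ne h2
  simp only [mixedColoring, columnColoring]
  split_ifs <;> grind

/-- The proper colorings of the grid by `2|α| - 1` colors. -/
abbrev GridColoring (z : α) := {G : α × α → α ⊕ {j : α // j ≠ z} // GridCompatible G G}

/-- With `2|α| - 1` colors, the standard row coloring is joined to every row coloring and every
column coloring. -/
theorem reflTransGen_gridCompatible [DecidableEq α] (z : α) {τ : α → α} (hτ : Function.Injective τ)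
    (i : Bool) : Relation.ReflTransGen (fun G H : GridColoring z => GridCompatible G.1 H.1)
      ⟨rowColoring z id, gridCompatible_row z Function.injective_id⟩
      (if i then ⟨rowColoring z τ, gridCompatible_row z hτ⟩
        else ⟨columnColoring z τ, gridCompatible_column z hτ⟩) := by
  refine .trans (b := ⟨mixedColoring z id, gridCompatible_mixed z _ _⟩)
    (.single (gridCompatible_row_mixed z Function.injective_id)) ?_
  cases i
  · exact .head (b := ⟨mixedColoring z fun _ => τ z, gridCompatible_mixed z _ _⟩)
      (gridCompatible_mixed z id fun _ => τ z) (.single (gridCompatible_mixed_column z hτ))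
  · exact .head (b := ⟨mixedColoring z τ, gridCompatible_mixed z _ _⟩)
      (gridCompatible_mixed z id τ) (.single (gridCompatible_row_mixed z hτ).symm)

theorem swapAut_mul_self (k : ℕ) : swapAut k * swapAut k = 1 := by
  ext v <;> rfl

theorem swapHom_eq_or (k : ℕ) (n : Multiplicative ℤ) :
    swapHom k n = 1 ∨ swapHom k n = swapAut k := by
  have h : swapHom k n = swapAut k ^ n.toAdd := by simp [swapHom, zpowersHom_apply]
  rw [h]
  have h2 : swapAut k ^ (2 : ℤ) = 1 := by
    rw [zpow_two, swapAut_mul_self]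
  rcases Int.even_or_odd' n.toAdd with ⟨m, hm | hm⟩
  · left
    rw [hm, zpow_mul, h2, one_zpow]
  · right
    rw [hm, zpow_add, zpow_mul, h2, one_zpow, one_mul, zpow_one]

theorem swapHom_apply_mem_torusGens {k : ℕ} (n : Multiplicative ℤ) {v : Torus k}
    (hv : v ∈ torusGens k) : swapHom k n v ∈ torusGens k := by
  rcases swapHom_eq_or k n with h | h <;> rw [h]
  · exact hv
  · exact swapAut_mem_torusGens hv

/-- The upper bound for `Γ_k`. -/
theorem gamma_le (k : ℕ) (hk : 3 ≤ k) :
    measureChromaticNumber (shiftGraph (gammaMarking k hk)) ≤ ((2 * k - 1 : ℕ) : ℕ∞) := by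
  have : NeZero k := ⟨by omega⟩
  have : Finite (Torus k) := inferInstanceAs (Finite (ZMod k × ZMod k))
  have : Countable (Multiplicative ℤ) := inferInstanceAs (Countable ℤ)
  have : Countable (Gamma k) := SemidirectProduct.equivProd.injective.countable
  let b : Bool × ZMod k → GridColoring (0 : ZMod k) := fun u =>
    if u.1 then ⟨rowColoring 0 (· - u.2), gridCompatible_row 0 sub_left_injective⟩
      else ⟨columnColoring 0 (· - u.2), gridCompatible_column 0 sub_left_injective⟩
  obtain ⟨f, N, hf⟩ := exists_paths_of_reflTransGen (b := b) (fun G => G.2)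
    fun u => reflTransGen_gridCompatible (0 : ZMod k) (τ := (· - u.2)) sub_left_injective u.1
  have key : ∀ g : Gamma k, ∃ i, ∀ v : Torus k,
      (b i).1 v.toAdd = .inl ((swapHom k g.right v).toAdd.1 - g.left.toAdd.1) := by
    intro g
    rcases swapHom_eq_or k g.right with h | h <;> rw [h]
    · exact ⟨(true, g.left.toAdd.1), fun v => rfl⟩
    · exact ⟨(false, g.left.toAdd.1), fun v => rfl⟩
  choose i hi using key
  let π : Gamma k →* Multiplicative ℤ := SemidirectProduct.rightHom
  have hlev : ∀ g : Gamma k, level π g = g.right.toAdd := fun _ => rfl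
  obtain ⟨c, hc⟩ := exists_measurable_coloring (π := π) (gammaMarking k hk) (L := N)
    (fun s hs => abs_le_one_of_mem_steps hs.2) SemidirectProduct.rightHom_surjective
    (fun L => by
      refine Set.Finite.subset (((Set.finite_univ (α := Torus k)).prod
        ((Set.finite_Icc (-L) L).preimage Multiplicative.toAdd.injective.injOn)).preimage
        (f := SemidirectProduct.equivProd) SemidirectProduct.equivProd.injective.injOn) ?_
      intro g hg
      exact ⟨Set.mem_univ _, abs_le.1 hg⟩)
    (Int.natCast_nonneg N)
    (σ := fun h => .inl h.left.toAdd.1)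
    (P := fun g h => (f (i g) h.right.toAdd.toNat).1 ((swapHom k h.right)⁻¹ h.left).toAdd)
    (by
      intro g _ s hs h
      have hmem := swapHom_apply_mem_torusGens (h.right⁻¹ * s.right⁻¹) hs.1
      have e : (swapHom k (s * h).right)⁻¹ (s * h).left =
          swapHom k (h.right⁻¹ * s.right⁻¹) s.left * (swapHom k h.right)⁻¹ h.left := by
        rw [SemidirectProduct.mul_right, SemidirectProduct.mul_left, ← map_inv, mul_inv_rev,
          map_mul (swapHom k _), ← map_inv, map_mul (swapHom k), MulAut.mul_apply,
          MulAut.mul_apply, map_inv, map_inv, MulAut.inv_apply_self]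
      rw [e]
      refine path_rel (R := fun G H : GridColoring (0 : ZMod k) => GridCompatible G.1 H.1)
        (fun G => G.2) (fun _ _ => GridCompatible.symm)
        (hf _).2.1 (abs_le_one_of_mem_steps hs.2) _ _ ?_ ?_
      · intro e
        exact hmem.1 (by simpa using e)
      · intro e
        exact hmem.2 (by simpa using e))
    (by
      intro g _ h h0
      rw [hlev] at h0
      have h1 : h.right = 1 := h0
      simp only [h1, toAdd_one, Int.toNat_zero, (hf _).1]
      simp [rowColoring])
    (by
      intro g hg h h0
      rw [hlev] at h0 hg
      have h1 : h.right = 1 := h0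
      simp only [SemidirectProduct.mul_right, SemidirectProduct.mul_left, h1, one_mul]
      rw [(hf _).2.2 _ (by omega), hi]
      simp)
  refine measureChromaticNumber_le ?_ c hc
  rw [Fintype.card_sum, Fintype.card_subtype_compl, Fintype.card_subtype_eq, ZMod.card]
  omega

end Gamma

/-! ### Irrational rotations of the circle -/

section Circle

/-- An open half circle. -/
def arc : Set UnitAddCircle := (fun a : ℝ => (a : UnitAddCircle)) '' Set.Ioo 0 (1 / 2)

theorem isOpen_coe_image {s : Set ℝ} (hs : IsOpen s) :
    IsOpen ((fun a : ℝ => (a : UnitAddCircle)) '' s) :=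
  QuotientAddGroup.isOpenMap_coe s hs

theorem isOpen_arc : IsOpen arc :=
  isOpen_coe_image isOpen_Ioo

theorem arc_nonempty : arc.Nonempty :=
  ⟨_, 1 / 4, ⟨by norm_num, by norm_num⟩, rfl⟩

theorem coe_notMem_arc {b : ℝ} (hb : b ∈ Set.Ioo (1 / 2 : ℝ) 1) : (b : UnitAddCircle) ∉ arc := by
  rintro ⟨a, ha, e⟩
  have h := (AddCircle.coe_eq_coe_iff_of_mem_Ico (p := (1 : ℝ)) (a := 0) (x := a) (y := b)
    ⟨ha.1.le, by linarith [ha.2]⟩ ⟨by linarith [hb.1], by linarith [hb.2]⟩).1 e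
  linarith [ha.2, hb.1]

/-- A nontrivial rotation moves some point of a given dense set out of the arc. -/
theorem exists_mem_arc_add_notMem_arc {ι : Type*} {f : ι → UnitAddCircle} (hf : DenseRange f)
    {β : UnitAddCircle} (hβ : β ≠ 0) : ∃ i, f i ∈ arc ∧ f i + β ∉ arc := by
  obtain ⟨b, hb, rfl⟩ : ∃ b ∈ Set.Ico (0 : ℝ) 1, (b : UnitAddCircle) = β := by
    have : β ∈ (fun a : ℝ => (a : UnitAddCircle)) '' Set.Ico 0 (0 + 1) := by
      rw [AddCircle.coe_image_Ico_eq]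
      trivial
    simpa using this
  have hb0 : 0 < b := lt_of_le_of_ne hb.1 fun h => hβ (by rw [← h, AddCircle.coe_zero])
  set J : Set UnitAddCircle := (fun a : ℝ => (a : UnitAddCircle)) '' Set.Ioo (1 / 2) 1
  have hJ : IsOpen J := isOpen_coe_image isOpen_Ioo
  have hU : IsOpen (arc ∩ (fun φ => φ + (b : UnitAddCircle)) ⁻¹' J) :=
    isOpen_arc.inter (hJ.preimage (continuous_add_const _))
  -- The point `(1 - b) / 2` of the arc is rotated to `(1 + b) / 2`, inside the opposite half
  -- circle.
  obtain ⟨i, hi⟩ := hf.exists_mem_open hU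
    ⟨(((1 - b) / 2 : ℝ) : UnitAddCircle), ⟨_, ⟨by linarith [hb.2], by linarith⟩, rfl⟩,
      ⟨(1 + b) / 2, ⟨by linarith, by linarith [hb.2]⟩, by
        simp only [← AddCircle.coe_add]
        congr 1
        ring⟩⟩
  refine ⟨i, hi.1, ?_⟩
  obtain ⟨a, ha, e⟩ := hi.2
  simp only at e
  rw [← e]
  exact coe_notMem_arc ha

/-- An irrational angle. -/
noncomputable def angle : UnitAddCircle := ((√2 : ℝ) : UnitAddCircle)

theorem denseRange_zsmul_angle : DenseRange fun n : ℤ => n • angle := by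
  have := (AddCircle.denseRange_zsmul_coe_iff (a := √2) (p := 1)).2
    (by simpa using irrational_sqrt_two)
  exact this

theorem addOrderOf_angle : addOrderOf angle = 0 :=
  AddCircle.denseRange_zsmul_iff.1 denseRange_zsmul_angle

theorem injective_zsmul_angle : Function.Injective fun n : ℤ => n • angle :=
  injective_zsmul_iff_not_isOfFinAddOrder.2 (addOrderOf_eq_zero_iff.1 addOrderOf_angle)

theorem ergodic_add_angle : Ergodic (fun θ : UnitAddCircle => θ + angle) :=
  AddCircle.ergodic_add_right.2 addOrderOf_angle

theorem ergodic_add_two_angle : Ergodic (fun θ : UnitAddCircle => θ + (angle + angle)) := by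
  refine AddCircle.ergodic_add_right.2 ?_
  rw [← two_nsmul]
  refine addOrderOf_eq_zero_iff'.2 fun n hn h => ?_
  rw [← mul_nsmul] at h
  exact addOrderOf_eq_zero_iff'.1 addOrderOf_angle (2 * n) (by omega) h

instance isProbabilityMeasure_circle : IsProbabilityMeasure (volume : Measure UnitAddCircle) :=
  ⟨UnitAddCircle.measure_univ⟩

end Circle

/-! ### Coding rotations into the free part -/

section RotationPoint

variable {Γ A : Type*} [Group Γ] [AddCommGroup A] (j : Multiplicative A →* Γ)
  (ψ : A →+ UnitAddCircle)

open Classical in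
/-- The itinerary of `θ` under the rotations `ψ`, placed along the image of `j`. -/
noncomputable def itinerary (θ : UnitAddCircle) (h : Γ) : Bool :=
  decide (∃ a, j (.ofAdd a) = h ∧ θ - ψ a ∈ arc)

variable {j ψ}

theorem itinerary_eq_true {θ : UnitAddCircle} {h : Γ} :
    itinerary j ψ θ h = true ↔ ∃ a, j (.ofAdd a) = h ∧ θ - ψ a ∈ arc := by
  simp [itinerary]

theorem shift_itinerary (a : A) (θ : UnitAddCircle) :
    shift (j (.ofAdd a)) (itinerary j ψ θ) = itinerary j ψ (θ + ψ a) := by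
  funext h
  rw [Bool.eq_iff_iff, shift, itinerary_eq_true, itinerary_eq_true]
  constructor
  · rintro ⟨b, hb, hm⟩
    refine ⟨a + b, by rw [ofAdd_add, map_mul, hb, mul_inv_cancel_left], ?_⟩
    rwa [map_add, add_comm (ψ a), add_sub_add_right_eq_sub]
  · rintro ⟨b, hb, hm⟩
    refine ⟨b - a, by rw [sub_eq_neg_add, ofAdd_add, ofAdd_neg, map_mul, map_inv, hb], ?_⟩
    rwa [map_sub, sub_sub_eq_add_sub]

/-- The itinerary is supported on the image of `j`, so a stabilizing element lies in that image. It
acts as a rotation, and a nontrivial rotation would carry some visit out of the arc. -/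
theorem itinerary_mem_freePart (hj : Function.Injective j) (hψ : Function.Injective ψ)
    (hd : DenseRange ψ) (θ : UnitAddCircle) : itinerary j ψ θ ∈ freePart Γ := by
  have hd' : DenseRange fun a => θ - ψ a :=
    (Homeomorph.subLeft θ).surjective.denseRange.comp hd (Homeomorph.subLeft θ).continuous
  intro g hg e
  have hmove : ∀ h, itinerary j ψ θ h = true → itinerary j ψ θ (g⁻¹ * h) = true := by
    intro h hh
    rw [← e] at hh
    exact hh
  obtain ⟨a, ha⟩ := hd'.exists_mem_open isOpen_arc arc_nonempty
  obtain ⟨b, hb, -⟩ := itinerary_eq_true.1 (hmove _ (itinerary_eq_true.2 ⟨a, rfl, ha⟩))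
  have hgc : j (.ofAdd (a - b)) = g := by
    rw [sub_eq_add_neg, ofAdd_add, ofAdd_neg, map_mul, map_inv, hb]
    group
  have hc : ψ (a - b) ≠ 0 := by
    intro h
    have h0 := hψ (h.trans (map_zero ψ).symm)
    exact hg (by rw [← hgc, h0, ofAdd_zero, map_one])
  obtain ⟨a', h1, h2⟩ := exists_mem_arc_add_notMem_arc hd' hc
  obtain ⟨b', hb', hm⟩ := itinerary_eq_true.1 (hmove _ (itinerary_eq_true.2 ⟨a', rfl, h1⟩))
  have : b' = a' - (a - b) := by
    apply Multiplicative.ofAdd.injective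
    apply hj
    rw [hb', ← hgc, sub_eq_neg_add a', ofAdd_add, ofAdd_neg, map_mul, map_inv]
  rw [this, map_sub, ← sub_add] at hm
  exact h2 hm

theorem measurable_itinerary : Measurable (itinerary j ψ) := by
  refine measurable_pi_iff.2 fun h => measurable_to_bool ?_
  have e : (fun θ => itinerary j ψ θ h) ⁻¹' {true} =
      {θ | ∃ a, j (.ofAdd a) = h ∧ θ - ψ a ∈ arc} := by
    ext θ
    exact itinerary_eq_true
  rw [e]
  refine IsOpen.measurableSet ?_
  have e' : {θ | ∃ a, j (.ofAdd a) = h ∧ θ - ψ a ∈ arc} =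
      ⋃ (a) (_ : j (.ofAdd a) = h), (fun θ => θ - ψ a) ⁻¹' arc := by
    ext θ
    simp
  rw [e']
  exact isOpen_iUnion fun a => isOpen_iUnion fun _ =>
    isOpen_arc.preimage (continuous_sub_right _)

/-- Finitely many probability measures are dominated by a single one. -/
theorem exists_isProbabilityMeasure_absolutelyContinuous {ι X : Type*} [Finite ι] [Nonempty ι]
    [MeasurableSpace X] (μ : ι → Measure X) [∀ i, IsProbabilityMeasure (μ i)] :
    ∃ ν : Measure X, IsProbabilityMeasure ν ∧ ∀ i, μ i ≪ ν := by
  have := Fintype.ofFinite ι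
  refine ⟨(Fintype.card ι : ENNReal)⁻¹ • ∑ i, μ i, ⟨?_⟩, fun i s hs => ?_⟩
  · simp [ENNReal.inv_mul_cancel]
  · simp only [Measure.smul_apply, Measure.finsetSum_apply, smul_eq_mul, mul_eq_zero,
      ENNReal.inv_eq_zero, ENNReal.natCast_ne_top, false_or, Finset.sum_eq_zero_iff,
      Finset.mem_univ, true_imp_iff] at hs
    exact hs i

/-- There are an equivariant map from a circle on which a subgroup acts by rotations to the free
part, and a measure for which the pullbacks of all measurable colorings along finitely many
translates of this map are measurable. -/
theorem exists_rotation_measure (hj : Function.Injective j) (hψ : Function.Injective ψ)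
    (hd : DenseRange ψ) {ι : Type*} [Finite ι] [Nonempty ι] (v : ι → Γ) :
    ∃ (p : UnitAddCircle → freePart Γ) (μ : Measure (freePart Γ)), IsProbabilityMeasure μ ∧
      (∀ a θ, j (.ofAdd a) • p θ = p (θ + ψ a)) ∧
      ∀ {C : Type} [MeasurableSpace C] (c : freePart Γ → C), NullMeasurable c μ →
        ∀ i, NullMeasurable (fun θ => c (v i • p θ)) := by
  set p : UnitAddCircle → freePart Γ :=
    fun θ => ⟨itinerary j ψ θ, itinerary_mem_freePart hj hψ hd θ⟩
  have hp : Measurable p := measurable_itinerary.subtype_mk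
  have hvp : ∀ i, Measurable fun θ => v i • p θ :=
    fun i => (measurable_smul_freePart (v i)).comp hp
  have : ∀ i, IsProbabilityMeasure ((volume : Measure UnitAddCircle).map fun θ => v i • p θ) :=
    fun i => Measure.isProbabilityMeasure_map (hvp i).aemeasurable
  obtain ⟨μ, hμ, hac⟩ := exists_isProbabilityMeasure_absolutelyContinuous
    fun i => (volume : Measure UnitAddCircle).map fun θ => v i • p θ
  refine ⟨p, μ, hμ, fun a θ => Subtype.ext (shift_itinerary a θ), fun c hc i => ?_⟩
  exact hc.comp_quasiMeasurePreserving ⟨hvp i, hac i⟩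

end RotationPoint

/-! ### Lower bounds from ergodicity -/

section LowerBounds

/-- There is no null measurable set which an irrational rotation moves to its complement. -/
theorem not_forall_add_angle_mem_iff {E : Set UnitAddCircle}
    (hE : NullMeasurableSet E (volume : Measure UnitAddCircle)) :
    ¬ ∀ θ, θ + angle ∈ E ↔ θ ∉ E := by
  intro h
  have hinv : (fun θ => θ + (angle + angle)) ⁻¹' E = E := by
    ext θ
    rw [Set.mem_preimage, ← add_assoc, h, h, not_not]
  have hflip : (fun θ => θ + angle) ⁻¹' E = Eᶜ := by
    ext θ
    exact h θ
  have hm : volume Eᶜ = volume E := by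
    rw [← hflip]
    exact ergodic_add_angle.measure_preimage hE
  have h1 := measure_add_measure_compl₀ hE
  rw [hm, UnitAddCircle.measure_univ] at h1
  rcases ergodic_add_two_angle.quasiErgodic.ae_empty_or_univ₀ hE (.of_eq hinv) with h0 | h0
  · rw [measure_congr h0, measure_empty] at h1
    simp at h1
  · have := measure_congr h0.compl
    rw [hm, Set.compl_univ, measure_empty] at this
    rw [this] at h1
    simp at h1

/-- The embedding of `Z_k × ℤ` into `Δ_k` in which `Z_k` is the diagonal. -/
def diagonalHom (k : ℕ) : Multiplicative (ZMod k × ℤ) →* Delta k where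
  toFun a := (.ofAdd (a.toAdd.1, a.toAdd.1), .ofAdd a.toAdd.2)
  map_one' := rfl
  map_mul' _ _ := rfl

theorem diagonalHom_injective (k : ℕ) : Function.Injective (diagonalHom k) := fun _ _ e =>
  Prod.ext (congrArg (fun g : Delta k => g.1.toAdd.1) e)
    (congrArg (fun g : Delta k => g.2.toAdd) e)

/-- The homomorphism from `Z_k × ℤ` to the circle given by rotations by `1 / k` and by an irrational
angle. -/
noncomputable def rotationHom (k : ℕ) [NeZero k] : ZMod k × ℤ →+ UnitAddCircle :=
  ZMod.toAddCircle.coprod (zmultiplesHom UnitAddCircle angle)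

theorem rotationHom_apply (k : ℕ) [NeZero k] (a : ZMod k × ℤ) :
    rotationHom k a = ZMod.toAddCircle a.1 + a.2 • angle :=
  rfl

theorem rotationHom_zero_one (k : ℕ) [NeZero k] : rotationHom k (0, 1) = angle := by
  rw [rotationHom_apply, map_zero, zero_add, one_smul]

/-- Multiplying by `k` kills the torsion part and leaves an integer multiple of an angle of infinite
order. -/
theorem rotationHom_injective (k : ℕ) [NeZero k] : Function.Injective (rotationHom k) := by
  refine (injective_iff_map_eq_zero _).2 ?_
  rintro ⟨a, n⟩ e
  rw [rotationHom_apply] at e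
  have h1 : k • (ZMod.toAddCircle a : UnitAddCircle) = 0 := by
    rw [← map_nsmul]
    simp
  have h2 : ((k : ℤ) * n) • angle = (0 : ℤ) • angle := by
    have := congrArg (fun x => k • x) e
    simp only [nsmul_add, h1, zero_add, nsmul_zero] at this
    rw [mul_smul, zero_smul, natCast_zsmul, this]
  have h3 : (k : ℤ) * n = 0 := injective_zsmul_angle h2
  obtain rfl : n = 0 :=
    (mul_eq_zero.1 h3).resolve_left (Int.natCast_ne_zero.2 (NeZero.ne k))
  simp only [zero_smul, add_zero, ZMod.toAddCircle_eq_zero] at e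
  rw [e]
  rfl

theorem denseRange_rotationHom (k : ℕ) [NeZero k] : DenseRange (rotationHom k) := by
  refine denseRange_zsmul_angle.mono ?_
  rintro _ ⟨n, rfl⟩
  exact ⟨(0, n), by simp [rotationHom_apply]⟩

theorem one_mem_steps : (1 : Multiplicative ℤ) ∈ steps :=
  Or.inr (Or.inl rfl)

theorem ofAdd_one_mem_steps : (.ofAdd 1 : Multiplicative ℤ) ∈ steps :=
  Or.inr (Or.inr rfl)

theorem gridCompatible_delta {k : ℕ} {hk : 3 ≤ k} {C : Type*}
    (c : (shiftGraph (deltaMarking k hk)).Coloring C) (y : freePart (Delta k))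
    {m n s : Multiplicative ℤ} (hs : s ∈ steps) (hn : s * m = n) :
    GridCompatible (fun v : ZMod k × ZMod k => c (((.ofAdd v, m) : Delta k) • y))
      (fun v : ZMod k × ZMod k => c (((.ofAdd v, n) : Delta k) • y)) := by
  intro v w h1 h2
  refine c.valid ((shiftGraph_adj_iff _ _ _).2 ⟨(.ofAdd (w - v), s), ⟨?_, hs⟩, ?_⟩)
  · exact ⟨sub_ne_zero.2 h1.symm, sub_ne_zero.2 h2.symm⟩
  · rw [← mul_smul, Prod.mk_mul_mk, hn, ← ofAdd_add, sub_add_cancel]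

/-- Colorings of the shift graph of `Δ_k` by at most `k` colors are invariant under `ℤ`. -/
theorem coloring_delta_invariant {k : ℕ} {hk : 3 ≤ k} {m : ℕ} (hm : m ≤ k)
    (c : (shiftGraph (deltaMarking k hk)).Coloring (Fin m)) (y : freePart (Delta k)) :
    c (((1, .ofAdd 1) : Delta k) • y) = c y := by
  have : NeZero k := ⟨by omega⟩
  have h := GridCompatible.eq (gridCompatible_delta c y one_mem_steps (one_mul 1))
    (gridCompatible_delta c y one_mem_steps (one_mul (Multiplicative.ofAdd 1)))
    (gridCompatible_delta c y ofAdd_one_mem_steps (mul_one (Multiplicative.ofAdd 1)))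
    (by rwa [Fintype.card_fin, ZMod.card])
  have h0 : c ((1 : Delta k) • y) = c (((1, .ofAdd 1) : Delta k) • y) := congrFun h (0, 0)
  rw [← h0, one_smul]

/-- The lower bound for `Δ_k`. -/
theorem delta_ge (k : ℕ) (hk : 3 ≤ k) :
    ((k + 1 : ℕ) : ℕ∞) ≤ measureChromaticNumber (shiftGraph (deltaMarking k hk)) := by
  have : NeZero k := ⟨by omega⟩
  have : Fact (1 < k) := ⟨by omega⟩
  obtain ⟨p, μ, hμ, hp, hmeas⟩ := exists_rotation_measure (diagonalHom_injective k)
    (rotationHom_injective k) (denseRange_rotationHom k) fun _ : Unit => (1 : Delta k)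
  refine le_measureChromaticNumber μ fun m hm c hc => ?_
  have hnull := hmeas _ hc ()
  simp only [one_smul] at hnull
  have : Nonempty (Fin m) := ⟨c (p 0)⟩
  have hinv : ∀ θ, c (p (θ + angle)) = c (p θ) := by
    intro θ
    rw [← rotationHom_zero_one k, ← hp (0, 1) θ]
    exact coloring_delta_invariant (by omega) c (p θ)
  obtain ⟨d, hd⟩ := ergodic_add_angle.ae_eq_const_of_ae_eq_comp₀ hnull (.of_eq (funext hinv))
  have hconst : ∀ᵐ θ : UnitAddCircle, c (p θ) = d := hd
  have hpres := (measurePreserving_add_right (volume : Measure UnitAddCircle)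
    (rotationHom k (1, 0))).quasiMeasurePreserving
  have hrot : ∀ᵐ θ : UnitAddCircle, c (p (θ + rotationHom k (1, 0))) = d :=
    hpres.ae (p := fun θ => c (p θ) = d) hconst
  -- The diagonal generator `(1, 1)` acts as a rotation, so some edge has both ends of the a.e.
  -- color `d`.
  obtain ⟨θ, h1, h2⟩ := (hconst.and hrot).exists
  have hs : diagonalHom k (.ofAdd (1, 0)) ∈ (deltaMarking k hk).gens :=
    ⟨⟨one_ne_zero, one_ne_zero⟩, one_mem_steps⟩
  have hadj : (shiftGraph (deltaMarking k hk)).Adj (p θ) (p (θ + rotationHom k (1, 0))) :=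
    (shiftGraph_adj_iff _ _ _).2 ⟨_, hs, hp (1, 0) θ⟩
  exact c.valid hadj (h1.trans h2.symm)

/-- The lower bound for `Γ_k`. -/
theorem gamma_ge (k : ℕ) (hk : 3 ≤ k) :
    ((2 * k - 1 : ℕ) : ℕ∞) ≤ measureChromaticNumber (shiftGraph (gammaMarking k hk)) := by
  have : NeZero k := ⟨by omega⟩
  let j : Multiplicative ℤ →* Gamma k := SemidirectProduct.inr
  let ψ : ℤ →+ UnitAddCircle := zmultiplesHom UnitAddCircle angle
  obtain ⟨p, μ, hμ, hp, hmeas⟩ := exists_rotation_measure (j := j) (ψ := ψ)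
    SemidirectProduct.inr_injective injective_zsmul_angle denseRange_zsmul_angle
    fun v : ZMod k × ZMod k => (⟨.ofAdd v, 1⟩ : Gamma k)
  refine le_measureChromaticNumber μ fun m hm c hc => ?_
  have hcard : Fintype.card (Fin m) + 1 < 2 * Fintype.card (ZMod k) := by
    rw [Fintype.card_fin, ZMod.card]
    omega
  let G : UnitAddCircle → ZMod k × ZMod k → Fin m :=
    fun θ v => c ((⟨.ofAdd v, 1⟩ : Gamma k) • p θ)
  have hG : ∀ θ, GridCompatible (G θ) (G θ) := by
    intro θ v w h1 h2
    refine c.valid ((shiftGraph_adj_iff _ _ _).2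
      ⟨⟨.ofAdd (w - v), 1⟩, ⟨⟨sub_ne_zero.2 h1.symm, sub_ne_zero.2 h2.symm⟩, Or.inr (Or.inl rfl)⟩,
        ?_⟩)
    rw [← mul_smul]
    congr 1
    ext1
    · simp
    · simp
  -- Moving the generator of `ℤ` past a torus element swaps its coordinates, whence the transposed
  -- grid.
  have hGs : ∀ θ, GridCompatible (G θ) (G (θ + angle) ∘ Prod.swap) := by
    intro θ v w h1 h2
    have hpt : p (θ + angle) = (⟨1, .ofAdd 1⟩ : Gamma k) • p θ := by
      have := hp 1 θ
      rw [show ψ 1 = angle from one_zsmul _] at this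
      exact this.symm
    refine c.valid ((shiftGraph_adj_iff _ _ _).2
      ⟨⟨.ofAdd (w - v).swap, .ofAdd 1⟩,
        ⟨⟨sub_ne_zero.2 h2.symm, sub_ne_zero.2 h1.symm⟩, Or.inr (Or.inr rfl)⟩, ?_⟩)
    rw [hpt, ← mul_smul, ← mul_smul]
    congr 1
    ext1
    · simp only [SemidirectProduct.mul_left, swapHom_one, map_one, mul_one]
      exact congrArg Multiplicative.ofAdd (congrArg Prod.swap (sub_add_cancel w v))
    · simp only [SemidirectProduct.mul_right, one_mul, mul_one]
  have hnull : NullMeasurableSet {θ | RowType (G θ)} (volume : Measure UnitAddCircle) := by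
    have e : {θ | RowType (G θ)} = ⋂ i, ⋃ (a) (b) (_ : a ≠ b) (d),
        ((fun θ => G θ (i, b)) ⁻¹' {d} ∩ (fun θ => G θ (i, a)) ⁻¹' {d}) := by
      ext θ
      simp [RowType]
    rw [e]
    exact .iInter fun i => .iUnion fun a => .iUnion fun b => .iUnion fun _ => .iUnion fun d =>
      (hmeas _ hc (i, b) (measurableSet_singleton d)).inter
        (hmeas _ hc (i, a) (measurableSet_singleton d))
  refine not_forall_add_angle_mem_iff hnull fun θ => ?_
  have hlt : Fintype.card (Fin m) < 2 * Fintype.card (ZMod k) := by omega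
  constructor
  · intro h1 h2
    exact RowType.not_rowType_comp_swap (hG θ) (hG (θ + angle)).comp_swap (hGs θ) hlt h2 h1
  · intro h
    have h' := (rowType_or_rowType_comp_swap (hG θ) hcard).resolve_left h
    have h1 := RowType.not_rowType_comp_swap (hG θ).comp_swap (hG (θ + angle))
      (hGs θ).comp_swap hlt h'
    exact (rowType_or_rowType_comp_swap (hG (θ + angle)) hcard).resolve_right h1

end LowerBounds

end ShiftGraphs

theorem proposition4p2 (k : ℕ) (hk : 3 ≤ k) :
    ShiftGraphs.measureChromaticNumber (ShiftGraphs.shiftGraph (ShiftGraphs.gammaMarking k hk)) =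
        ((2 * k - 1 : ℕ) : ℕ∞) ∧
      ShiftGraphs.measureChromaticNumber (ShiftGraphs.shiftGraph (ShiftGraphs.deltaMarking k hk)) =
        ((k + 1 : ℕ) : ℕ∞) :=
  ⟨le_antisymm (ShiftGraphs.gamma_le k hk) (ShiftGraphs.gamma_ge k hk),
    le_antisymm (ShiftGraphs.delta_le k hk) (ShiftGraphs.delta_ge k hk)⟩
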